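/- Let $d$ be a natural number and let $\rho,\sigma$ be $d\times d$ complex density matrices (positive semidefinite matrices of trace one). A unital quantum channel is a completely positive, trace-preserving linear map $\Phi$ on the $d\times d$ complex matrices with $\Phi(I)=I$. Let $F(\rho,\sigma)=\operatorname{Tr}\sqrt{\sqrt{\rho}\,\sigma\sqrt{\rho}}$ denote the quantum fidelity, and for vectors $p,q\in[0,\infty)^d$ let $F(p,q)=\sum_{j=1}^d\sqrt{p_jq_j}$ denote the classical fidelity. Let $\lambda^{\downarrow}(\rho)$ and $\lambda^{\uparrow}(\sigma)$ be the vectors of eigenvalues, with multiplicity, of $\rho$ in non-increasing order and of $\sigma$ in non-decreasing order, respectively. Then \[\min_{\Phi}F(\rho,\Phi(\sigma))=F(\lambda^{\downarrow}(\rho),\lambda^{\uparrow}(\sigma)),\] where $\Phi$ ranges over all unital quantum channels on the $d\times d$ complex matrices, and the minimum is attained. -/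

import Mathlib

open scoped ComplexOrder MatrixOrder Matrix.Norms.L2Operator CStarAlgebra

noncomputable section

namespace QuantumFidelity

/-- Complex `d × d` matrices, with the operator norm and the Loewner order. -/
abbrev Mat (d : ℕ) : Type := Matrix (Fin d) (Fin d) ℂ

/-- A density matrix: positive semidefinite with unit trace. -/
structure IsDensityMatrix {d : ℕ} (ρ : Mat d) : Prop where
  posSemidef : ρ.PosSemidef
  trace_eq_one : ρ.trace = 1

theorem IsDensityMatrix.isHermitian {d : ℕ} {ρ : Mat d} (hρ : IsDensityMatrix ρ) :
    ρ.IsHermitian :=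
  hρ.posSemidef.isHermitian

/-- A unital quantum channel: a completely positive, trace-preserving linear map `Φ` on the
`d × d` complex matrices with `Φ(I) = I`. -/
structure IsUnitalChannel {d : ℕ} (Φ : Mat d →CP Mat d) : Prop where
  trace_map : ∀ X : Mat d, (Φ X).trace = X.trace
  map_one : Φ 1 = 1

/-- The quantum fidelity `Tr √(√ρ σ √ρ)`. The trace is a real number, see `coe_fidelity`. -/
def fidelity {d : ℕ} (ρ σ : Mat d) : ℝ :=
  (CFC.sqrt (CFC.sqrt ρ * σ * CFC.sqrt ρ)).trace.re

theorem coe_fidelity {d : ℕ} (ρ σ : Mat d) :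
    (fidelity ρ σ : ℂ) = (CFC.sqrt (CFC.sqrt ρ * σ * CFC.sqrt ρ)).trace := by
  have h : 0 ≤ (CFC.sqrt (CFC.sqrt ρ * σ * CFC.sqrt ρ)).trace :=
    (Matrix.nonneg_iff_posSemidef.mp (CFC.sqrt_nonneg _)).trace_nonneg
  exact Complex.ext rfl (by simpa using (Complex.le_def.mp h).2)

/-- The classical fidelity `∑ⱼ √(pⱼ qⱼ)` of two vectors. -/
def classicalFidelity {d : ℕ} (p q : Fin d → ℝ) : ℝ :=
  ∑ j, √(p j * q j)

/-- The eigenvalues of a Hermitian matrix, with multiplicity, in non-increasing order. -/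
def eigenvaluesDesc {d : ℕ} {A : Mat d} (hA : A.IsHermitian) : Fin d → ℝ :=
  fun j => hA.eigenvalues₀ (Fin.cast (Fintype.card_fin d).symm j)

/-- The eigenvalues of a Hermitian matrix, with multiplicity, in non-decreasing order. -/
def eigenvaluesAsc {d : ℕ} {A : Mat d} (hA : A.IsHermitian) : Fin d → ℝ :=
  fun j => eigenvaluesDesc hA j.rev

end QuantumFidelity

end

/-!
The lower bound rests on a chain of three inequalities, with `a = √λ↓(ρ)` and `b = √λ↑(σ)`:

  `F(ρ, Φ σ) ≥ Re Tr (√ρ √(Φ σ)) ≥ Re Tr (√ρ Φ(√σ)) ≥ ∑ⱼ aⱼ bⱼ`.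

* The fidelity is the trace norm of `√ρ √(Φ σ)`, which dominates the real part of its trace
  (`re_trace_le_re_trace_sqrt`, `re_trace_sqrt_mul_sqrt_le_fidelity`).
* Kadison's inequality gives `Φ(√σ)² ≤ Φ σ`, and the square root is operator monotone, so
  `Φ(√σ) ≤ √(Φ σ)` (`CompletelyPositiveMap.star_map_mul_map_le`, `map_sqrt_le_sqrt_map`).
* In eigenbases `(uᵢ)` of `ρ` and `(vⱼ)` of `σ`, `Tr (√ρ Φ(√σ)) = ∑ᵢⱼ aᵢ Dᵢⱼ bⱼ` with
  `Dᵢⱼ = ⟨uᵢ, Φ(vⱼ vⱼ*) uᵢ⟩`. Since `Φ` is positive, unital and trace-preserving, `D` is doubly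
  stochastic, hence a convex combination of permutation matrices, and the rearrangement inequality
  bounds each permuted sum from below by the oppositely ordered one
  (`Antivary.sum_mul_le_dotProduct_mulVec`, `sum_mul_le_re_trace_conjDiagonal_mul_map`).

The bound is attained by the unitary conjugation that carries an eigenbasis of `σ`, in
non-decreasing order, to an eigenbasis of `ρ`, in non-increasing order: the two states then commute
and the fidelity is the classical one (`exists_isUnitalChannel_fidelity_eq`).
-/

namespace QuantumFidelity

open Matrix Finset

/-! ### Doubly stochastic matrices and rearrangement -/

section Majorization

variable {n : Type*} [Fintype n] [DecidableEq n]

/-- Birkhoff's theorem writes `D` as a convex combination of permutation matrices, and the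
rearrangement inequality applies to each of them. -/
theorem _root_.Antivary.sum_mul_le_dotProduct_mulVec {a b : n → ℝ} (hab : Antivary a b)
    {D : Matrix n n ℝ} (hD : D ∈ doublyStochastic ℝ n) :
    ∑ i, a i * b i ≤ a ⬝ᵥ (D *ᵥ b) := by
  obtain ⟨w, hw0, hw1, rfl⟩ := exists_eq_sum_perm_of_mem_doublyStochastic hD
  have key : ∀ π : Equiv.Perm n, a ⬝ᵥ (π.permMatrix ℝ *ᵥ b) = ∑ i, a i * b (π i) := by
    intro π
    simp [Matrix.permMatrix_mulVec, dotProduct]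
  simp only [Matrix.sum_mulVec, dotProduct_sum, Matrix.smul_mulVec, dotProduct_smul, key,
    smul_eq_mul]
  calc ∑ i, a i * b i = ∑ π : Equiv.Perm n, w π * ∑ i, a i * b i := by
        rw [← Finset.sum_mul, hw1, one_mul]
    _ ≤ _ := Finset.sum_le_sum fun π _ =>
        mul_le_mul_of_nonneg_left hab.sum_mul_le_sum_mul_comp_perm (hw0 π)

/-- The transition matrix `D i j = ⟨i|Ψ(|j⟩⟨j|)|i⟩` of a linear map on matrices: the action of `Ψ`
on diagonal matrices, read off on the diagonal. -/
def transitionMatrix (Ψ : Matrix n n ℂ →ₗ[ℂ] Matrix n n ℂ) : Matrix n n ℝ :=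
  fun i j => (Ψ (Matrix.single j j 1) i i).re

theorem re_apply_diagonal_apply (Ψ : Matrix n n ℂ →ₗ[ℂ] Matrix n n ℂ) (b : n → ℝ) (i : n) :
    (Ψ (diagonal fun j => (b j : ℂ)) i i).re = (transitionMatrix Ψ *ᵥ b) i := by
  have h : diagonal (fun j => (b j : ℂ)) = ∑ j, (b j : ℂ) • Matrix.single j j (1 : ℂ) := by
    ext k l
    simp [Matrix.sum_apply, Matrix.single_apply, diagonal_apply, ite_and]
  simp only [h, map_sum, map_smul]
  simp [Matrix.sum_apply, mulVec, dotProduct, transitionMatrix, mul_comm,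
    -Matrix.smul_single]

theorem transitionMatrix_mem_doublyStochastic {Ψ : Matrix n n ℂ →ₗ[ℂ] Matrix n n ℂ}
    (hpos : ∀ X, 0 ≤ X → 0 ≤ Ψ X) (hone : Ψ 1 = 1) (htr : ∀ X, (Ψ X).trace = X.trace) :
    transitionMatrix Ψ ∈ doublyStochastic ℝ n := by
  rw [mem_doublyStochastic]
  refine ⟨fun i j => ?_, ?_, ?_⟩
  · have h : 0 ≤ Matrix.single j j (1 : ℂ) := by
      rw [nonneg_iff_posSemidef, ← Matrix.diagonal_single]
      exact PosSemidef.diagonal (Pi.single_nonneg.2 zero_le_one)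
    exact (Complex.le_def.1 ((nonneg_iff_posSemidef.1 (hpos _ h)).diag_nonneg (i := i))).1
  · ext i
    rw [← re_apply_diagonal_apply]
    simp [hone]
  · ext j
    have h := congrArg Complex.re (htr (Matrix.single j j 1))
    simpa [Matrix.trace, transitionMatrix, vecMul, dotProduct] using h

/-- The bilinear form `Tr (diag(a) Ψ(diag(b)))` of a positive, unital, trace-preserving map is that
of its doubly stochastic transition matrix. -/
theorem sum_mul_le_re_trace_diagonal_mul {Ψ : Matrix n n ℂ →ₗ[ℂ] Matrix n n ℂ}
    (hpos : ∀ X, 0 ≤ X → 0 ≤ Ψ X) (hone : Ψ 1 = 1) (htr : ∀ X, (Ψ X).trace = X.trace)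
    {a b : n → ℝ} (hab : Antivary a b) :
    ∑ i, a i * b i ≤
      (diagonal (fun i => (a i : ℂ)) * Ψ (diagonal fun i => (b i : ℂ))).trace.re := by
  refine (hab.sum_mul_le_dotProduct_mulVec
    (transitionMatrix_mem_doublyStochastic hpos hone htr)).trans_eq ?_
  simp [Matrix.trace, dotProduct, ← re_apply_diagonal_apply]

end Majorization

/-! ### Diagonalization with ordered eigenvalues -/

section Diagonalization

variable {d : ℕ}

/-- The matrix `V diag(a) V*` with eigenvalues `a` in the orthonormal basis given by the columns
of the unitary `V`. -/
def conjDiagonal (V : unitary (Mat d)) (a : Fin d → ℝ) : Mat d :=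
  Unitary.conjStarAlgAut ℂ (Mat d) V (diagonal fun j => (a j : ℂ))

theorem conjDiagonal_mul (V : unitary (Mat d)) (a b : Fin d → ℝ) :
    conjDiagonal V a * conjDiagonal V b = conjDiagonal V (a * b) := by
  simp only [conjDiagonal]
  rw [← map_mul, diagonal_mul_diagonal]
  simp

theorem conjDiagonal_nonneg (V : unitary (Mat d)) {a : Fin d → ℝ} (ha : 0 ≤ a) :
    0 ≤ conjDiagonal V a :=
  map_nonneg _ (nonneg_iff_posSemidef.2 (PosSemidef.diagonal fun j => by simpa using ha j))

theorem sqrt_conjDiagonal (V : unitary (Mat d)) {a : Fin d → ℝ} (ha : 0 ≤ a) :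
    CFC.sqrt (conjDiagonal V a) = conjDiagonal V fun j => √(a j) := by
  refine CFC.sqrt_unique ?_ (conjDiagonal_nonneg V fun j => Real.sqrt_nonneg _)
  rw [conjDiagonal_mul]
  congr 1
  ext j
  exact Real.mul_self_sqrt (ha j)

theorem trace_conjStarAlgAut (V : unitary (Mat d)) (X : Mat d) :
    (Unitary.conjStarAlgAut ℂ (Mat d) V X).trace = X.trace := by
  rw [Unitary.conjStarAlgAut_apply, trace_mul_comm, ← mul_assoc]
  simp

theorem trace_conjDiagonal (V : unitary (Mat d)) (a : Fin d → ℝ) :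
    (conjDiagonal V a).trace = ∑ j, (a j : ℂ) := by
  rw [conjDiagonal, trace_conjStarAlgAut, trace_diagonal]

/-- Listing the eigenvalues in another order amounts to permuting the columns of the unitary. -/
theorem exists_conjDiagonal_comp_eq (V : unitary (Mat d)) (e : Equiv.Perm (Fin d))
    (a : Fin d → ℝ) : ∃ V' : unitary (Mat d), conjDiagonal V' (a ∘ e) = conjDiagonal V a := by
  refine ⟨⟨(V : Mat d).submatrix id e, ?_⟩, ?_⟩
  · rw [← Matrix.unitaryGroup, mem_unitaryGroup_iff, star_eq_conjTranspose, conjTranspose_submatrix,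
      submatrix_mul_equiv]
    simpa [star_eq_conjTranspose] using! V.2.2
  · have h : diagonal (fun j => (((a ∘ e) j : ℝ) : ℂ)) =
        (diagonal fun j => (a j : ℂ)).submatrix e e := by
      rw [submatrix_diagonal_equiv]; rfl
    simp only [conjDiagonal, Unitary.conjStarAlgAut_apply]
    rw [h, star_eq_conjTranspose, conjTranspose_submatrix, submatrix_mul_equiv,
      submatrix_mul_equiv]
    simp [star_eq_conjTranspose]

theorem exists_eigenvaluesDesc_eq {A : Mat d} (hA : A.IsHermitian) :
    ∃ e : Equiv.Perm (Fin d), eigenvaluesDesc hA = hA.eigenvalues ∘ e := by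
  refine ⟨(finCongr (Fintype.card_fin d).symm).trans
    (Fintype.equivOfCardEq (Fintype.card_fin _)), ?_⟩
  ext j
  simp [eigenvaluesDesc, IsHermitian.eigenvalues]

theorem exists_eq_conjDiagonal_eigenvaluesDesc {A : Mat d} (hA : A.IsHermitian) :
    ∃ V : unitary (Mat d), A = conjDiagonal V (eigenvaluesDesc hA) := by
  obtain ⟨e, he⟩ := exists_eigenvaluesDesc_eq hA
  obtain ⟨V, hV⟩ := exists_conjDiagonal_comp_eq hA.eigenvectorUnitary e hA.eigenvalues
  exact ⟨V, by rw [he, hV]; exact hA.spectral_theorem⟩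

theorem exists_eq_conjDiagonal_eigenvaluesAsc {A : Mat d} (hA : A.IsHermitian) :
    ∃ V : unitary (Mat d), A = conjDiagonal V (eigenvaluesAsc hA) := by
  obtain ⟨V, hV⟩ := exists_eq_conjDiagonal_eigenvaluesDesc hA
  obtain ⟨V', hV'⟩ := exists_conjDiagonal_comp_eq V Fin.revPerm (eigenvaluesDesc hA)
  exact ⟨V', hV.trans hV'.symm⟩

theorem antitone_eigenvaluesDesc {A : Mat d} (hA : A.IsHermitian) :
    Antitone (eigenvaluesDesc hA) :=
  fun _ _ h => hA.eigenvalues₀_antitone h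

theorem monotone_eigenvaluesAsc {A : Mat d} (hA : A.IsHermitian) :
    Monotone (eigenvaluesAsc hA) :=
  fun _ _ h => antitone_eigenvaluesDesc hA (Fin.rev_le_rev.2 h)

theorem eigenvaluesDesc_nonneg {A : Mat d} (hA : A.PosSemidef) :
    0 ≤ eigenvaluesDesc hA.isHermitian := by
  obtain ⟨e, he⟩ := exists_eigenvaluesDesc_eq hA.isHermitian
  rw [he]
  exact fun j => hA.eigenvalues_nonneg _

theorem eigenvaluesAsc_nonneg {A : Mat d} (hA : A.PosSemidef) :
    0 ≤ eigenvaluesAsc hA.isHermitian :=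
  fun j => eigenvaluesDesc_nonneg hA j.rev

end Diagonalization

/-! ### Trace inequalities and the fidelity -/

section Fidelity

variable {d : ℕ}

/-- The trace norm dominates the real part of the trace. In an orthonormal eigenbasis `w` of
`P = √(A A*)` one has `Re ⟨wᵢ, A wᵢ⟩ = Re ⟨A* wᵢ, wᵢ⟩ ≤ ‖A* wᵢ‖ = ⟨wᵢ, P wᵢ⟩`. -/
theorem re_trace_le_re_trace_sqrt (A : Mat d) :
    A.trace.re ≤ (CFC.sqrt (A * star A)).trace.re := by
  set P := CFC.sqrt (A * star A)
  have hP0 : 0 ≤ P := CFC.sqrt_nonneg _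
  have hPsd := nonneg_iff_posSemidef.1 hP0
  obtain ⟨V, hV⟩ := exists_eq_conjDiagonal_eigenvaluesDesc hPsd.isHermitian
  set s := eigenvaluesDesc hPsd.isHermitian
  have hs : 0 ≤ s := eigenvaluesDesc_nonneg hPsd
  have hPP : P * P = A * star A := CFC.sqrt_mul_sqrt_self _ (mul_star_self_nonneg _)
  set c := Unitary.conjStarAlgAut ℂ (Mat d) V
  obtain ⟨B, rfl⟩ := EquivLike.surjective c A
  -- In the eigenbasis of `P`, row `i` of `A` has squared length `sᵢ²`.
  have hBB : B * star B = diagonal fun j => ((s j * s j : ℝ) : ℂ) := by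
    apply EquivLike.injective c
    rw [map_mul, map_star, ← hPP, hV, conjDiagonal_mul]
    rfl
  rw [hV, trace_conjDiagonal, trace_conjStarAlgAut]
  simp only [Matrix.trace, Complex.re_sum, Complex.ofReal_re, diag_apply]
  refine Finset.sum_le_sum fun i _ => ?_
  have h1 : ∑ j, Complex.normSq (B i j) = s i * s i := by
    have h := congrFun (congrFun hBB i) i
    simp only [mul_apply, star_apply, diagonal_apply_eq, RCLike.star_def, Complex.mul_conj] at h
    exact_mod_cast h
  have h2 : Complex.normSq (B i i) ≤ s i * s i :=
    h1 ▸ Finset.single_le_sum (f := fun j => Complex.normSq (B i j))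
      (fun j _ => Complex.normSq_nonneg _) (Finset.mem_univ i)
  refine le_of_sq_le_sq ?_ (hs i)
  rw [Complex.normSq_apply] at h2
  nlinarith [mul_self_nonneg (B i i).im]

/-- The fidelity is the trace norm of `√ρ √τ`, because `(√ρ √τ) (√ρ √τ)* = √ρ τ √ρ`. -/
theorem re_trace_sqrt_mul_sqrt_le_fidelity (ρ : Mat d) {τ : Mat d} (hτ : 0 ≤ τ) :
    (CFC.sqrt ρ * CFC.sqrt τ).trace.re ≤ fidelity ρ τ := by
  refine (re_trace_le_re_trace_sqrt _).trans_eq ?_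
  have hρ : star (CFC.sqrt ρ) = CFC.sqrt ρ := (CFC.sqrt_nonneg ρ).isSelfAdjoint
  have hsτ : star (CFC.sqrt τ) = CFC.sqrt τ := (CFC.sqrt_nonneg τ).isSelfAdjoint
  rw [fidelity, star_mul, hρ, hsτ, mul_assoc, ← mul_assoc (CFC.sqrt τ),
    CFC.sqrt_mul_sqrt_self τ hτ, ← mul_assoc]

theorem re_trace_mul_le_re_trace_mul {A B C : Mat d} (hA : 0 ≤ A) (hBC : B ≤ C) :
    (A * B).trace.re ≤ (A * C).trace.re := by
  have h : 0 ≤ (A * (C - B)).trace := by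
    rw [← CFC.sqrt_mul_sqrt_self A hA, mul_assoc, trace_mul_comm]
    exact (nonneg_iff_posSemidef.1 ((CFC.sqrt_nonneg A).isSelfAdjoint.conjugate_nonneg
      (sub_nonneg.2 hBC))).trace_nonneg
  rw [mul_sub, trace_sub] at h
  simpa using (Complex.le_def.1 h).1

theorem fidelity_conjDiagonal (V : unitary (Mat d)) {p q : Fin d → ℝ} (hp : 0 ≤ p) (hq : 0 ≤ q) :
    fidelity (conjDiagonal V p) (conjDiagonal V q) = classicalFidelity p q := by
  rw [fidelity, sqrt_conjDiagonal V hp, conjDiagonal_mul, conjDiagonal_mul, sqrt_conjDiagonal,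
    trace_conjDiagonal, classicalFidelity, Complex.re_sum]
  · refine Finset.sum_congr rfl fun j _ => ?_
    simp only [Pi.mul_apply, Complex.ofReal_re]
    rw [mul_right_comm, Real.mul_self_sqrt (hp j)]
  · exact fun j => mul_nonneg (mul_nonneg (Real.sqrt_nonneg _) (hq j)) (Real.sqrt_nonneg _)

end Fidelity

/-! ### Kadison's inequality and the square root -/

section Kadison

/-- Sums of matrices `S* S` have diagonal entries that are sums of elements `s* s`. -/
theorem _root_.CStarMatrix.diag_nonneg {A n : Type*} [CStarAlgebra A] [PartialOrder A]
    [StarOrderedRing A] [Fintype n] [DecidableEq n] {M : CStarMatrix n n A} (hM : 0 ≤ M) (i : n) : 0 ≤ M i i := by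
  rw [StarOrderedRing.nonneg_iff] at hM
  induction hM using AddSubmonoid.closure_induction with
  | mem _ h =>
    obtain ⟨S, rfl⟩ := h
    simp only [CStarMatrix.mul_apply, CStarMatrix.star_apply]
    exact Finset.sum_nonneg fun k _ => star_mul_self_nonneg _
  | zero => exact le_rfl
  | add _ _ _ _ hx hy => exact add_nonneg hx hy

/-- **Kadison's inequality** for a unital completely positive map. The matrix with rows
`(x* x, x*)` and `(x, 1)` is positive, hence so is its image under `Φ`, and the Schur complement of
the corner `1` in the image is `Φ(x* x) - Φ(x*) Φ(x)`. -/
theorem _root_.CompletelyPositiveMap.star_map_mul_map_le {A B : Type*} [CStarAlgebra A]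
    [PartialOrder A] [StarOrderedRing A] [CStarAlgebra B] [PartialOrder B] [StarOrderedRing B]
    (Φ : A →CP B) (hΦ : Φ 1 = 1) (x : A) : star (Φ x) * Φ x ≤ Φ (star x * x) := by
  -- `R* R` is the matrix with rows `(x* x, x*)` and `(x, 1)`.
  let R : CStarMatrix (Fin 2) (Fin 2) A := CStarMatrix.ofMatrix !![x, 1; 0, 0]
  have hM := CompletelyPositiveMapClass.map_cstarMatrix_nonneg' (A₂ := B) Φ 2 _ (star_mul_self_nonneg R)
  -- Conjugation by a matrix with first column `(1, -Φ x)` puts the Schur complement in the corner.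
  let C : CStarMatrix (Fin 2) (Fin 2) B := CStarMatrix.ofMatrix !![1, 0; -Φ x, 0]
  have h := CStarMatrix.diag_nonneg (star_left_conjugate_nonneg hM C) 0
  have hstar : Φ (star x) = star (Φ x) := by
    have h01 := congrFun (congrFun hM.isSelfAdjoint.star_eq 0) 1
    simpa [CStarMatrix.mul_apply, CStarMatrix.star_apply, R, Fin.sum_univ_two] using h01.symm
  simpa [CStarMatrix.mul_apply, CStarMatrix.star_apply, R, C, Fin.sum_univ_two, hΦ, hstar] using h

/-- Jensen's inequality for the operator square root: Kadison's inequality gives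
`Φ(√x)² ≤ Φ x`, and the square root is operator monotone. -/
theorem map_sqrt_le_sqrt_map {A B : Type*} [CStarAlgebra A]
    [PartialOrder A] [StarOrderedRing A] [CStarAlgebra B] [PartialOrder B] [StarOrderedRing B]
    (Φ : A →CP B) (hΦ : Φ 1 = 1) {x : A} (hx : 0 ≤ x) : Φ (CFC.sqrt x) ≤ CFC.sqrt (Φ x) := by
  have h0 : 0 ≤ Φ (CFC.sqrt x) := map_nonneg Φ (CFC.sqrt_nonneg x)
  have h := Φ.star_map_mul_map_le hΦ (CFC.sqrt x)
  rw [(CFC.sqrt_nonneg x).isSelfAdjoint.star_eq, h0.isSelfAdjoint.star_eq,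
    CFC.sqrt_mul_sqrt_self x hx] at h
  simpa [CFC.sqrt_mul_self _ h0] using CFC.sqrt_le_sqrt _ _ h

end Kadison

/-! ### The minimum over unital channels -/

section Minimum

variable {d : ℕ}

/-- The rearrangement bound for a unital channel between two arbitrary orthonormal bases. -/
theorem sum_mul_le_re_trace_conjDiagonal_mul_map {Φ : Mat d →CP Mat d} (hΦ : IsUnitalChannel Φ)
    (V W : unitary (Mat d)) {a b : Fin d → ℝ} (hab : Antivary a b) :
    ∑ i, a i * b i ≤ (conjDiagonal V a * Φ (conjDiagonal W b)).trace.re := by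
  -- `Ψ` is the channel `Φ` written in the orthonormal bases given by `W` and `V`.
  let Ψ : Mat d →ₗ[ℂ] Mat d :=
    { toFun := fun X => (Unitary.conjStarAlgAut ℂ (Mat d) V).symm
        (Φ (Unitary.conjStarAlgAut ℂ (Mat d) W X))
      map_add' := fun X Y => by simp only [map_add]
      map_smul' := fun c X => by simp only [map_smul, RingHom.id_apply] }
  have hΨ : ∀ X, Unitary.conjStarAlgAut ℂ (Mat d) V (Ψ X) =
      Φ (Unitary.conjStarAlgAut ℂ (Mat d) W X) :=
    fun X => StarAlgEquiv.apply_symm_apply _ _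
  have htr : ∀ X, (Ψ X).trace = X.trace := fun X => by
    rw [← trace_conjStarAlgAut V, hΨ, hΦ.trace_map, trace_conjStarAlgAut]
  have hone : Ψ 1 = 1 := by
    apply EquivLike.injective (Unitary.conjStarAlgAut ℂ (Mat d) V)
    rw [hΨ, map_one, hΦ.map_one, map_one]
  have hpos : ∀ X, 0 ≤ X → 0 ≤ Ψ X := fun X hX =>
    map_nonneg (Unitary.conjStarAlgAut ℂ (Mat d) V).symm (map_nonneg Φ (map_nonneg _ hX))
  refine (sum_mul_le_re_trace_diagonal_mul hpos hone htr hab).trans_eq ?_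
  rw [conjDiagonal, conjDiagonal, ← hΨ, ← map_mul, trace_conjStarAlgAut]

theorem isUnitalChannel_conjStarAlgAut (U : unitary (Mat d)) :
    IsUnitalChannel
      (CompletelyPositiveMapClass.toCompletelyPositiveLinearMap
        (Unitary.conjStarAlgAut ℂ (Mat d) U)) where
  trace_map := trace_conjStarAlgAut U
  map_one := map_one (Unitary.conjStarAlgAut ℂ (Mat d) U)

theorem classicalFidelity_le_fidelity_map {ρ σ : Mat d} (hρ : ρ.PosSemidef) (hσ : σ.PosSemidef)
    {Φ : Mat d →CP Mat d} (hΦ : IsUnitalChannel Φ) :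
    classicalFidelity (eigenvaluesDesc hρ.isHermitian) (eigenvaluesAsc hσ.isHermitian) ≤
      fidelity ρ (Φ σ) := by
  have hσ0 : 0 ≤ σ := nonneg_iff_posSemidef.2 hσ
  obtain ⟨V, hV⟩ := exists_eq_conjDiagonal_eigenvaluesDesc hρ.isHermitian
  obtain ⟨W, hW⟩ := exists_eq_conjDiagonal_eigenvaluesAsc hσ.isHermitian
  set p := eigenvaluesDesc hρ.isHermitian
  set q := eigenvaluesAsc hσ.isHermitian
  have hp0 : 0 ≤ p := eigenvaluesDesc_nonneg hρ
  have hq0 : 0 ≤ q := eigenvaluesAsc_nonneg hσ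
  have hanti : Antivary (fun j => √(p j)) fun j => √(q j) :=
    Antitone.antivary (fun _ _ h => Real.sqrt_le_sqrt (antitone_eigenvaluesDesc _ h))
      fun _ _ h => Real.sqrt_le_sqrt (monotone_eigenvaluesAsc _ h)
  calc classicalFidelity p q = ∑ j, √(p j) * √(q j) :=
        Finset.sum_congr rfl fun j _ => Real.sqrt_mul (hp0 j) _
    _ ≤ (CFC.sqrt ρ * Φ (CFC.sqrt σ)).trace.re := by
        rw [hV, hW, sqrt_conjDiagonal V hp0, sqrt_conjDiagonal W hq0]
        exact sum_mul_le_re_trace_conjDiagonal_mul_map hΦ V W hanti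
    _ ≤ (CFC.sqrt ρ * CFC.sqrt (Φ σ)).trace.re :=
        re_trace_mul_le_re_trace_mul (CFC.sqrt_nonneg ρ) (map_sqrt_le_sqrt_map Φ hΦ.map_one hσ0)
    _ ≤ fidelity ρ (Φ σ) := re_trace_sqrt_mul_sqrt_le_fidelity ρ (map_nonneg Φ hσ0)

theorem exists_isUnitalChannel_fidelity_eq {ρ σ : Mat d} (hρ : ρ.PosSemidef)
    (hσ : σ.PosSemidef) : ∃ Φ : Mat d →CP Mat d, IsUnitalChannel Φ ∧
      classicalFidelity (eigenvaluesDesc hρ.isHermitian) (eigenvaluesAsc hσ.isHermitian) =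
        fidelity ρ (Φ σ) := by
  obtain ⟨V, hV⟩ := exists_eq_conjDiagonal_eigenvaluesDesc hρ.isHermitian
  obtain ⟨W, hW⟩ := exists_eq_conjDiagonal_eigenvaluesAsc hσ.isHermitian
  -- `V W*` carries the ordered eigenbasis of `σ` to that of `ρ`.
  refine ⟨_, isUnitalChannel_conjStarAlgAut (V * star W), ?_⟩
  have h : Unitary.conjStarAlgAut ℂ (Mat d) (V * star W) σ =
      conjDiagonal V (eigenvaluesAsc hσ.isHermitian) := by
    conv_lhs => rw [hW]
    rw [conjDiagonal, ← StarAlgEquiv.mul_apply, ← map_mul, mul_assoc, Unitary.star_mul_self,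
      mul_one, conjDiagonal]
  change _ = fidelity ρ (Unitary.conjStarAlgAut ℂ (Mat d) (V * star W) σ)
  rw [h]
  conv_rhs => rw [hV]
  exact (fidelity_conjDiagonal V (eigenvaluesDesc_nonneg hρ) (eigenvaluesAsc_nonneg hσ)).symm

end Minimum

end QuantumFidelity

theorem mainTheorem1 {d : ℕ} (ρ σ : QuantumFidelity.Mat d)
    (hρ : QuantumFidelity.IsDensityMatrix ρ) (hσ : QuantumFidelity.IsDensityMatrix σ) :
    IsLeast
      {x : ℝ | ∃ Φ : QuantumFidelity.Mat d →CP QuantumFidelity.Mat d,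
        QuantumFidelity.IsUnitalChannel Φ ∧ x = QuantumFidelity.fidelity ρ (Φ σ)}
      (QuantumFidelity.classicalFidelity
        (QuantumFidelity.eigenvaluesDesc hρ.isHermitian)
        (QuantumFidelity.eigenvaluesAsc hσ.isHermitian)) := by
  refine ⟨QuantumFidelity.exists_isUnitalChannel_fidelity_eq hρ.posSemidef hσ.posSemidef, ?_⟩
  rintro x ⟨Φ, hΦ, rfl⟩
  exact QuantumFidelity.classicalFidelity_le_fidelity_map hρ.posSemidef hσ.posSemidef hΦ
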